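/- For a Dirichlet series $f(s)=\sum_{n\ge 1} a_n n^{-s}$ with complex coefficients let $\sigma_c(f)\in[-\infty,\infty]$ be its abscissa of convergence, that is, the infimum of all $r\in\mathbb{R}$ such that the series converges at every $s$ with $\operatorname{Re} s>r$. Let $\mathcal{H}^\infty_+$ be the space of all analytic functions $f$ on $\{\operatorname{Re} s>0\}$ which are bounded on $\{\operatorname{Re} s>\varepsilon\}$ for each $\varepsilon>0$ and which can be represented as a Dirichlet series convergent in $\{\operatorname{Re} s>0\}$ (such functions are identified with their Dirichlet series), endowed with the locally convex topology defined by the seminorms $P_\varepsilon(f)=\sup_{\operatorname{Re} s>\varepsilon}|f(s)|$, $\varepsilon>0$. For a Dirichlet series $g(s)=\sum_{n\ge1} a_n n^{-s}$ put $g'(s)=-\sum_{n\ge 2} a_n(\log n)\,n^{-s}$, and for a Dirichlet series $h(s)=\sum_{n\ge 2} b_n n^{-s}$ with vanishing first coefficient put $J(h)(s)=-\sum_{n\ge 2}\frac{b_n}{\log n}\,n^{-s}$. The Volterra operator with symbol $g$ is the linear map $V_g(f)=J(g'f)$, where $g'f$ is the product of Dirichlet series (Dirichlet convolution of the coefficients),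 whose first coefficient is $0$. Let $g$ be a Dirichlet series with $\sigma_c(g)\le 0$. Then $V_g$ maps $\mathcal{H}^\infty_+$ into itself if and only if $g\in\mathcal{H}^\infty_+$. Moreover, if $V_g$ maps $\mathcal{H}^\infty_+$ into itself, then $V_g:\mathcal{H}^\infty_+\to\mathcal{H}^\infty_+$ is continuous. -/

import Mathlib

open Filter Topology

noncomputable section

namespace DirichletSpace

/-- The open half-plane of all `s` with `r < Re s`. -/
def halfPlane (r : ℝ) : Set ℂ := {s | r < s.re}

/-- The partial sum `∑_{n=1}^N a_n n^{-s}` of the Dirichlet series with coefficients `a`.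
A Dirichlet series is given by its coefficients `a_1, a_2, …`, that is, by an
`ArithmeticFunction ℂ`; the ring product there is the product of Dirichlet series. -/
def partialSum (a : ArithmeticFunction ℂ) (s : ℂ) (N : ℕ) : ℂ :=
  ∑ n ∈ Finset.Icc 1 N, a n * (n : ℂ) ^ (-s)

/-- (Possibly conditional) convergence of the Dirichlet series at the point `s`. -/
def ConvergesAt (a : ArithmeticFunction ℂ) (s : ℂ) : Prop :=
  ∃ l : ℂ, Tendsto (partialSum a s) atTop (𝓝 l)

/-- The sum of the Dirichlet series at a point where it converges. -/
def value (a : ArithmeticFunction ℂ) (s : ℂ) : ℂ := limUnder atTop (partialSum a s)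

/-- The abscissa of convergence `σ_c`; it is `⊤` if the series converges on no half-plane. -/
def abscissaOfConv (a : ArithmeticFunction ℂ) : EReal :=
  sInf ((fun r : ℝ => (r : EReal)) '' {r : ℝ | ∀ s ∈ halfPlane r, ConvergesAt a s})

lemma ConvergesAt.tendsto {a : ArithmeticFunction ℂ} {s : ℂ} (h : ConvergesAt a s) :
    Tendsto (partialSum a s) atTop (𝓝 (value a s)) :=
  tendsto_nhds_limUnder h

lemma tendsto_add {a b : ArithmeticFunction ℂ} {s : ℂ} (ha : ConvergesAt a s)
    (hb : ConvergesAt b s) :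
    Tendsto (partialSum (a + b) s) atTop (𝓝 (value a s + value b s)) := by
  refine (ha.tendsto.add hb.tendsto).congr fun N => ?_
  simp [partialSum, add_mul, Finset.sum_add_distrib]

lemma tendsto_smul {a : ArithmeticFunction ℂ} {s : ℂ} (c : ℂ) (ha : ConvergesAt a s) :
    Tendsto (partialSum (c • a) s) atTop (𝓝 (c * value a s)) := by
  refine (ha.tendsto.const_mul c).congr fun N => ?_
  simp [partialSum, Finset.mul_sum, mul_assoc]

lemma value_add {a b : ArithmeticFunction ℂ} {s : ℂ} (ha : ConvergesAt a s)
    (hb : ConvergesAt b s) : value (a + b) s = value a s + value b s :=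
  (tendsto_add ha hb).limUnder_eq

lemma value_smul {a : ArithmeticFunction ℂ} {s : ℂ} (c : ℂ) (ha : ConvergesAt a s) :
    value (c • a) s = c * value a s :=
  (tendsto_smul c ha).limUnder_eq

lemma tendsto_zero (s : ℂ) : Tendsto (partialSum 0 s) atTop (𝓝 0) := by
  have h : partialSum 0 s = fun _ => 0 := by
    funext N
    simp [partialSum]
  rw [h]
  exact tendsto_const_nhds

lemma value_zero (s : ℂ) : value 0 s = 0 := (tendsto_zero s).limUnder_eq

/-- The space of Dirichlet series that converge in the half-plane `Re s > 0` to an analytic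
function which is bounded on `Re s > ε` for each `ε > 0`. -/
def HInfPlus : Submodule ℂ (ArithmeticFunction ℂ) where
  carrier := {a | (∀ s ∈ halfPlane 0, ConvergesAt a s) ∧
    DifferentiableOn ℂ (value a) (halfPlane 0) ∧
    ∀ ε : ℝ, 0 < ε → ∃ C : ℝ, ∀ s ∈ halfPlane ε, ‖value a s‖ ≤ C}
  zero_mem' := by
    refine ⟨fun s _ => ⟨0, tendsto_zero s⟩, ?_, fun ε _ => ⟨0, fun s _ => by simp [value_zero]⟩⟩
    exact (differentiableOn_const 0).congr fun s _ => value_zero s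
  add_mem' := by
    rintro a b ⟨ha, ha', ha''⟩ ⟨hb, hb', hb''⟩
    refine ⟨fun s hs => ⟨_, tendsto_add (ha s hs) (hb s hs)⟩, ?_, fun ε hε => ?_⟩
    · exact (ha'.add hb').congr fun s hs => value_add (ha s hs) (hb s hs)
    · obtain ⟨C, hC⟩ := ha'' ε hε
      obtain ⟨C', hC'⟩ := hb'' ε hε
      refine ⟨C + C', fun s hs => ?_⟩
      have hs0 : s ∈ halfPlane 0 := lt_trans hε hs
      rw [value_add (ha s hs0) (hb s hs0)]
      exact (norm_add_le _ _).trans (add_le_add (hC s hs) (hC' s hs))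
  smul_mem' := by
    rintro c a ⟨ha, ha', ha''⟩
    refine ⟨fun s hs => ⟨_, tendsto_smul c (ha s hs)⟩, ?_, fun ε hε => ?_⟩
    · exact (ha'.const_mul c).congr fun s hs => value_smul c (ha s hs)
    · obtain ⟨C, hC⟩ := ha'' ε hε
      refine ⟨‖c‖ * C, fun s hs => ?_⟩
      have hs0 : s ∈ halfPlane 0 := lt_trans hε hs
      rw [value_smul c (ha s hs0), norm_mul]
      exact mul_le_mul_of_nonneg_left (hC s hs) (norm_nonneg c)

lemma HInfPlus.bddAbove (f : HInfPlus) {ε : ℝ} (hε : 0 < ε) :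
    BddAbove (Set.range fun s : halfPlane ε => ‖value f.1 s‖) := by
  obtain ⟨C, hC⟩ := f.2.2.2 ε hε
  exact ⟨C, by rintro _ ⟨s, rfl⟩; exact hC s s.2⟩

lemma HInfPlus.convergesAt (f : HInfPlus) {ε : ℝ} (hε : 0 < ε) (s : halfPlane ε) :
    ConvergesAt f.1 s :=
  f.2.1 s (lt_trans hε s.2)

lemma halfPlane_nonempty (r : ℝ) : Nonempty (halfPlane r) :=
  ⟨⟨((r + 1 : ℝ) : ℂ), by simp [halfPlane]⟩⟩

/-- The seminorms `P_ε f = sup {|f s| : Re s > ε}`, `ε > 0`. -/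
def supSeminorm : SeminormFamily ℂ HInfPlus {ε : ℝ // 0 < ε} := fun ε =>
  Seminorm.of (fun f => ⨆ s : halfPlane ε, ‖value f.1 s‖)
    (by
      intro f g
      have := halfPlane_nonempty ε
      refine ciSup_le fun s => ?_
      change ‖value (f.1 + g.1) s‖ ≤ _
      rw [value_add (HInfPlus.convergesAt f ε.2 s) (HInfPlus.convergesAt g ε.2 s)]
      exact (norm_add_le _ _).trans
        (add_le_add (le_ciSup (HInfPlus.bddAbove f ε.2) s) (le_ciSup (HInfPlus.bddAbove g ε.2) s)))
    (by
      intro c f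
      rw [Real.mul_iSup_of_nonneg (norm_nonneg c)]
      refine iSup_congr fun s => ?_
      change ‖value (c • f.1) s‖ = _
      rw [value_smul c (HInfPlus.convergesAt f ε.2 s), norm_mul])

/-- The locally convex topology defined by the seminorms `P_ε`, `ε > 0`. -/
instance : TopologicalSpace HInfPlus := supSeminorm.moduleFilterBasis.topology

/-- Term by term differentiation: `∑ a_n n^{-s}` becomes `-∑ a_n (log n) n^{-s}`. -/
def D : ArithmeticFunction ℂ →ₗ[ℂ] ArithmeticFunction ℂ where
  toFun a := ⟨fun n => -(a n * (Real.log n : ℂ)), by simp⟩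
  map_add' a b := by
    ext n
    change -((a n + b n) * (Real.log n : ℂ)) = -(a n * _) + -(b n * _)
    ring
  map_smul' c a := by
    ext n
    change -((c * a n) * (Real.log n : ℂ)) = c * -(a n * _)
    ring

/-- Term by term integration: `∑_{n≥2} a_n n^{-s}` becomes `-∑_{n≥2} (a_n / log n) n^{-s}`.
It is only meant for series with `a_1 = 0`; in general the term `a_1` is dropped. -/
def J : ArithmeticFunction ℂ →ₗ[ℂ] ArithmeticFunction ℂ where
  toFun a := ⟨fun n => if 2 ≤ n then -(a n / (Real.log n : ℂ)) else 0, by simp⟩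
  map_add' a b := by
    ext n
    change (if 2 ≤ n then -((a n + b n) / (Real.log n : ℂ)) else 0) =
      (if 2 ≤ n then -(a n / (Real.log n : ℂ)) else 0) +
      (if 2 ≤ n then -(b n / (Real.log n : ℂ)) else 0)
    split_ifs <;> ring
  map_smul' c a := by
    ext n
    change (if 2 ≤ n then -((c * a n) / (Real.log n : ℂ)) else 0) =
      c * (if 2 ≤ n then -(a n / (Real.log n : ℂ)) else 0)
    split_ifs <;> ring

/-- The first coefficient of `g' f` vanishes, so that `J` applies to it. -/
lemma D_mul_apply_one (g f : ArithmeticFunction ℂ) : (D g * f) 1 = 0 := by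
  have h : D g 1 = 0 := by
    change -(g 1 * ((Real.log (1 : ℕ) : ℝ) : ℂ)) = 0
    simp
  simp [h]

/-- The Volterra operator `V_g f = J (g' f)`, on Dirichlet series. -/
def volterra (g : ArithmeticFunction ℂ) : ArithmeticFunction ℂ →ₗ[ℂ] ArithmeticFunction ℂ where
  toFun f := J (D g * f)
  map_add' f₁ f₂ := by rw [mul_add, map_add]
  map_smul' c f := by
    have h : D g * (c • f) = c • (D g * f) := by
      ext n
      simp [Finset.mul_sum]
    rw [h, map_smul, RingHom.id_apply]

end DirichletSpace

end

noncomputable section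

namespace DirichletSpace

open MeasureTheory FourierTransform Convolution

/-!
Convolution along vertical lines with an integrable kernel `k` multiplies the `n`-th term of a
Dirichlet series by the inverse Fourier transform of `k` at `log n`. If `k` is the Fourier
transform of a trapezoid function that drops from `1` to `0` between `log N` and `log (N + 1)`, the
result is the `N`-th partial sum. The `L¹` norm of this kernel is `O(N ^ θ)` for each `θ > 0`, so on
a half-plane where the sum is bounded by `M` the partial sums are `O(N ^ θ) M`, and partial
summation turns this into `O(M)` after an arbitrarily small shift to the right.

Membership in `HInfPlus` therefore means that the partial sums are bounded on each half-plane
`Re s > ε`. Cauchy's estimate shows that `D` preserves this property, the product of two bounded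
sums is bounded, and partial summation with the decreasing weights `1 / log n` takes care of `J`.
Hence `V_g` acts continuously if `g` belongs to `HInfPlus`; the converse holds because
`V_g 1 = g - g 1`.
-/

/-! ### Trapezoid cutoffs and their Fourier transforms -/

/-- The indicator function of `[-R, R]`, the building block of the trapezoid functions. -/
def box (R : ℝ) : ℝ → ℂ := Set.indicator (Set.Icc (-R) R) 1

lemma box_eq_one {R x : ℝ} (hx : |x| ≤ R) : box R x = 1 :=
  Set.indicator_of_mem (abs_le.1 hx) 1

lemma box_eq_zero {R x : ℝ} (hx : R < |x|) : box R x = 0 :=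
  Set.indicator_of_notMem (fun h => hx.not_ge (abs_le.2 h)) 1

lemma integrable_box (R : ℝ) : Integrable (box R) :=
  (integrable_indicator_iff measurableSet_Icc).2
    (integrableOn_const measure_Icc_lt_top.ne)

lemma integral_box {R : ℝ} (hR : 0 ≤ R) : ∫ x, box R x = 2 * R := by
  rw [box, integral_indicator measurableSet_Icc]
  simp only [Pi.one_apply, setIntegral_const, Real.volume_real_Icc_of_le (neg_le_self hR)]
  simp
  ring

lemma fourier_box {R t : ℝ} (hR : 0 ≤ R) (ht : t ≠ 0) :
    𝓕 (box R) t = Complex.sin (2 * Real.pi * R * t) / (Real.pi * t) := by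
  have ht' : (t : ℂ) ≠ 0 := by exact_mod_cast ht
  have hπ : (Real.pi : ℂ) ≠ 0 := by exact_mod_cast Real.pi_ne_zero
  set c : ℂ := -2 * Real.pi * t * Complex.I with hc
  have hc0 : c ≠ 0 := by simp [hc, ht, Real.pi_ne_zero]
  have hint : ∀ x : ℝ, Complex.exp (↑(-2 * Real.pi * x * t) * Complex.I) • box R x =
      Set.indicator (Set.Icc (-R) R) (fun x : ℝ => Complex.exp (c * x)) x := by
    intro x
    rw [box, ← Set.indicator_smul_apply (Set.Icc (-R) R)
      (fun x : ℝ => Complex.exp (↑(-2 * Real.pi * x * t) * Complex.I)) 1 x]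
    congr 1
    funext y
    rw [Pi.one_apply, smul_eq_mul, mul_one, hc]
    congr 1
    push_cast
    ring
  rw [Real.fourier_real_eq_integral_exp_smul, funext hint, integral_indicator measurableSet_Icc,
    integral_Icc_eq_integral_Ioc, ← intervalIntegral.integral_of_le (by linarith),
    integral_exp_mul_complex hc0, Complex.sin, hc]
  push_cast
  rw [show -2 * Real.pi * t * Complex.I * R = -(2 * Real.pi * R * t : ℂ) * Complex.I by ring,
    show -2 * Real.pi * t * Complex.I * -R = (2 * Real.pi * R * t : ℂ) * Complex.I by ring]
  field_simp
  linear_combination (Complex.exp (2 * Real.pi * R * t * Complex.I) -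
    Complex.exp (-(2 * Real.pi * R * t * Complex.I))) * Complex.I_sq

lemma abs_sin_le_rpow {x α : ℝ} (h0 : 0 ≤ α) (h1 : α ≤ 1) : |Real.sin x| ≤ |x| ^ α := by
  rcases le_total |x| 1 with h | h
  · rcases eq_or_ne x 0 with rfl | hx
    · simpa using Real.rpow_nonneg le_rfl α
    · refine Real.abs_sin_le_abs.trans ?_
      simpa using Real.rpow_le_rpow_of_exponent_ge (abs_pos.2 hx) h h1
  · exact (Real.abs_sin_le_one x).trans (Real.one_le_rpow h h0)

lemma norm_fourier_box_le {R α t : ℝ} (hR : 0 ≤ R) (h0 : 0 ≤ α) (h1 : α ≤ 1) (ht : t ≠ 0) :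
    ‖𝓕 (box R) t‖ ≤ (2 * Real.pi * R) ^ α * |t| ^ (α - 1) := by
  have hτ : 0 < |t| := abs_pos.2 ht
  have hsin : |Real.sin (2 * Real.pi * R * t)| ≤ (2 * Real.pi * R) ^ α * |t| ^ α := by
    refine (abs_sin_le_rpow h0 h1).trans_eq ?_
    rw [abs_mul, abs_of_nonneg (by positivity), Real.mul_rpow (by positivity) hτ.le]
  calc ‖𝓕 (box R) t‖ = |Real.sin (2 * Real.pi * R * t)| / |t| / Real.pi := by
        rw [fourier_box hR ht, norm_div, norm_mul, Complex.norm_real, Complex.norm_real,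
          Real.norm_of_nonneg Real.pi_pos.le, Real.norm_eq_abs, div_div, mul_comm |t|]
        norm_cast
    _ ≤ |Real.sin (2 * Real.pi * R * t)| / |t| :=
        div_le_self (by positivity) (by linarith [Real.pi_gt_three])
    _ ≤ (2 * Real.pi * R) ^ α * |t| ^ α / |t| := by gcongr
    _ = (2 * Real.pi * R) ^ α * |t| ^ (α - 1) := by rw [Real.rpow_sub_one hτ.ne', mul_div_assoc]

/-- The trapezoid function with value `1` on `[-(P - δ), P - δ]` and `0` outside
`[-(P + δ), P + δ]`, for `0 < δ ≤ P`. Its Fourier transform is integrable, unlike that of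
`box P`. -/
def trapezoid (P δ : ℝ) : ℝ → ℂ :=
  ((2 * δ : ℝ) : ℂ)⁻¹ • (box P ⋆[ContinuousLinearMap.mul ℂ ℂ] box δ)

lemma trapezoid_apply (P δ x : ℝ) :
    trapezoid P δ x = ((2 * δ : ℝ) : ℂ)⁻¹ * ∫ y, box P y * box δ (x - y) := rfl

section Trapezoid

variable {P δ x t θ : ℝ}

lemma integrable_trapezoid (P δ : ℝ) : Integrable (trapezoid P δ) :=
  ((integrable_box P).integrable_convolution _ (integrable_box δ)).smul _

lemma trapezoid_eq_one (hδ : 0 < δ) (hx : |x| ≤ P - δ) : trapezoid P δ x = 1 := by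
  have hinner : ∀ y, box P y * box δ (x - y) = box δ (x - y) := by
    intro y
    rcases le_or_gt |x - y| δ with hy | hy
    · rw [box_eq_one (x := y) (by linarith [abs_sub_abs_le_abs_sub y x, abs_sub_comm x y]),
        one_mul]
    · rw [box_eq_zero hy, mul_zero]
  rw [trapezoid_apply, funext hinner, integral_sub_left_eq_self (box δ), integral_box hδ.le]
  have : (δ : ℂ) ≠ 0 := by exact_mod_cast hδ.ne'
  push_cast
  field_simp

lemma trapezoid_eq_zero (hx : P + δ < |x|) : trapezoid P δ x = 0 := by
  have hinner : ∀ y, box P y * box δ (x - y) = 0 := by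
    intro y
    rcases le_or_gt |y| P with hy | hy
    · rw [box_eq_zero (x := x - y) (by linarith [abs_sub_abs_le_abs_sub x y]), mul_zero]
    · rw [box_eq_zero hy, zero_mul]
  simp only [trapezoid_apply, hinner, integral_zero, mul_zero]

lemma continuousAt_trapezoid (hδ : 0 < δ) (hx : |x| < P - δ ∨ P + δ < |x|) :
    ContinuousAt (trapezoid P δ) x := by
  rcases hx with hx | hx
  · refine (continuousAt_const (y := (1 : ℂ))).congr ?_
    filter_upwards [(continuous_abs.tendsto x).eventually_lt_const hx] with y hy
    exact (trapezoid_eq_one hδ hy.le).symm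
  · refine (continuousAt_const (y := (0 : ℂ))).congr ?_
    filter_upwards [(continuous_abs.tendsto x).eventually_const_lt hx] with y hy
    exact (trapezoid_eq_zero hy).symm

lemma fourier_trapezoid (P δ t : ℝ) :
    𝓕 (trapezoid P δ) t = ((2 * δ : ℝ) : ℂ)⁻¹ * (𝓕 (box P) t * 𝓕 (box δ) t) := by
  rw [← Real.fourier_mul_convolution_eq (integrable_box P) (integrable_box δ)]
  exact congrFun (VectorFourier.fourierIntegral_const_smul _ _ _ _ _) t

lemma continuous_fourier_trapezoid (P δ : ℝ) : Continuous (𝓕 (trapezoid P δ)) :=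
  VectorFourier.fourierIntegral_continuous Real.continuous_fourierChar
    (by fun_prop) (integrable_trapezoid P δ)

lemma norm_fourier_trapezoid_le_rpow {α β : ℝ} (hP : 0 ≤ P) (hδ : 0 < δ) (hα₀ : 0 ≤ α)
    (hα₁ : α ≤ 1) (hβ₀ : 0 ≤ β) (hβ₁ : β ≤ 1) (ht : t ≠ 0) :
    ‖𝓕 (trapezoid P δ) t‖ ≤
      Real.pi * (2 * Real.pi * P) ^ α * (2 * Real.pi * δ) ^ (β - 1) * |t| ^ (α + β - 2) := by
  have hτ : 0 < |t| := abs_pos.2 ht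
  calc ‖𝓕 (trapezoid P δ) t‖
      = (2 * δ)⁻¹ * (‖𝓕 (box P) t‖ * ‖𝓕 (box δ) t‖) := by
        rw [fourier_trapezoid, norm_mul, norm_mul, norm_inv, Complex.norm_real,
          Real.norm_of_nonneg (by positivity)]
    _ ≤ (2 * δ)⁻¹ * (((2 * Real.pi * P) ^ α * |t| ^ (α - 1)) *
          ((2 * Real.pi * δ) ^ β * |t| ^ (β - 1))) := by
        gcongr
        · exact norm_fourier_box_le hP hα₀ hα₁ ht
        · exact norm_fourier_box_le hδ.le hβ₀ hβ₁ ht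
    _ = Real.pi * (2 * Real.pi * P) ^ α * (2 * Real.pi * δ) ^ (β - 1) * |t| ^ (α + β - 2) := by
        rw [show α + β - 2 = (α - 1) + (β - 1) by ring, Real.rpow_add hτ,
          Real.rpow_sub_one (x := 2 * Real.pi * δ) (by positivity)]
        field_simp

lemma norm_fourier_trapezoid_le_min (hP : 0 ≤ P) (hδ : 0 < δ) (h0 : 0 ≤ θ) (h1 : θ ≤ 1)
    (ht : t ≠ 0) :
    ‖𝓕 (trapezoid P δ) t‖ ≤ Real.pi * ((2 * Real.pi * P) ^ θ + (2 * Real.pi * δ) ^ (-θ)) *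
      min (|t| ^ (θ - 1)) (|t| ^ (-1 - θ)) := by
  -- The exponents `(θ, 1)` are suited to small `t` and `(0, 1 - θ)` to large `t`.
  have hsmall := norm_fourier_trapezoid_le_rpow hP hδ h0 h1 zero_le_one le_rfl ht
  have hlarge := norm_fourier_trapezoid_le_rpow hP hδ le_rfl zero_le_one (sub_nonneg.2 h1)
    (sub_le_self 1 h0) ht
  rw [sub_self, Real.rpow_zero, mul_one, show θ + 1 - 2 = θ - 1 by ring] at hsmall
  rw [Real.rpow_zero, mul_one, show 1 - θ - 1 = -θ by ring,
    show 0 + (1 - θ) - 2 = -1 - θ by ring] at hlarge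
  rw [mul_min_of_nonneg _ _ (by positivity)]
  refine le_min (hsmall.trans ?_) (hlarge.trans ?_)
  · gcongr
    exact le_add_of_nonneg_right (by positivity)
  · gcongr
    exact le_add_of_nonneg_left (by positivity)

lemma integrable_min_rpow (hθ : 0 < θ) :
    Integrable fun t : ℝ => min (|t| ^ (θ - 1)) (|t| ^ (-1 - θ)) := by
  have hmeas : Measurable fun t : ℝ => min (t ^ (θ - 1)) (t ^ (-1 - θ)) := by fun_prop
  have hnorm : ∀ t : ℝ, 0 < t → ‖min (t ^ (θ - 1)) (t ^ (-1 - θ))‖ =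
      min (t ^ (θ - 1)) (t ^ (-1 - θ)) := fun t ht =>
    Real.norm_of_nonneg (le_min (Real.rpow_nonneg ht.le _) (Real.rpow_nonneg ht.le _))
  refine (integrable_fun_norm_addHaar (E := ℝ) volume
    (f := fun t => min (t ^ (θ - 1)) (t ^ (-1 - θ)))).2 ?_
  simp only [Module.finrank_self, Nat.sub_self, pow_zero, one_smul]
  rw [← Set.Ioc_union_Ioi_eq_Ioi zero_le_one]
  refine IntegrableOn.union ?_ ?_
  · refine Integrable.mono' (intervalIntegral.intervalIntegrable_rpow' (a := 0) (b := 1)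
      (show -1 < θ - 1 by linarith)).1 hmeas.aestronglyMeasurable ?_
    filter_upwards [ae_restrict_mem measurableSet_Ioc] with t ht
    exact (hnorm t ht.1).trans_le (min_le_left _ _)
  · refine Integrable.mono' (integrableOn_Ioi_rpow_of_lt (show -1 - θ < -1 by linarith) one_pos)
      hmeas.aestronglyMeasurable ?_
    filter_upwards [ae_restrict_mem measurableSet_Ioi] with t ht
    exact (hnorm t (one_pos.trans ht)).trans_le (min_le_right _ _)

lemma integrable_fourier_trapezoid (hP : 0 ≤ P) (hδ : 0 < δ) :
    Integrable (𝓕 (trapezoid P δ)) := by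
  refine Integrable.mono' ((integrable_min_rpow one_pos).const_mul
    (Real.pi * ((2 * Real.pi * P) ^ (1 : ℝ) + (2 * Real.pi * δ) ^ (-1 : ℝ))))
    (continuous_fourier_trapezoid P δ).aestronglyMeasurable ?_
  filter_upwards [Measure.ae_ne volume (0 : ℝ)] with t ht
  exact norm_fourier_trapezoid_le_min hP hδ zero_le_one le_rfl ht

lemma integral_norm_fourier_trapezoid_le (hP : 0 ≤ P) (hδ : 0 < δ) (h0 : 0 < θ) (h1 : θ ≤ 1) :
    ∫ t, ‖𝓕 (trapezoid P δ) t‖ ≤ Real.pi * ((2 * Real.pi * P) ^ θ + (2 * Real.pi * δ) ^ (-θ)) *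
      ∫ t : ℝ, min (|t| ^ (θ - 1)) (|t| ^ (-1 - θ)) := by
  rw [← integral_const_mul]
  refine integral_mono_ae (integrable_fourier_trapezoid hP hδ).norm
    ((integrable_min_rpow h0).const_mul _) ?_
  filter_upwards [Measure.ae_ne volume (0 : ℝ)] with t ht
  exact norm_fourier_trapezoid_le_min hP hδ h0.le h1 ht

lemma fourierInv_fourier_trapezoid (hP : 0 ≤ P) (hδ : 0 < δ)
    (hx : |x| < P - δ ∨ P + δ < |x|) :
    𝓕⁻ (𝓕 (trapezoid P δ)) x = trapezoid P δ x :=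
  (integrable_trapezoid P δ).fourierInv_fourier_eq (integrable_fourier_trapezoid hP hδ)
    (continuousAt_trapezoid hδ hx)

end Trapezoid

section CutoffKernel

variable {N : ℕ}

/-- The midpoint of `log N` and `log (N + 1)`, where the cutoff kernel cuts off the frequencies. -/
def cutoffCenter (N : ℕ) : ℝ := (Real.log N + Real.log (N + 1)) / 2

/-- A quarter of the gap between `log N` and `log (N + 1)`, which keeps the slopes of the
trapezoid function of the cutoff kernel away from all frequencies `log n`. -/
def cutoffWidth (N : ℕ) : ℝ := (Real.log (N + 1) - Real.log N) / 4

/-- The integrable kernel whose inverse Fourier transform cuts off the frequencies `log n` after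
`n = N`. -/
def cutoffKernel (N : ℕ) : ℝ → ℂ := 𝓕 (trapezoid (cutoffCenter N) (cutoffWidth N))

lemma cutoffCenter_nonneg (N : ℕ) : 0 ≤ cutoffCenter N := by
  have h := Real.log_nonneg (show (1 : ℝ) ≤ N + 1 by simp)
  rw [cutoffCenter]
  positivity

lemma cutoffCenter_le (hN : 1 ≤ N) : cutoffCenter N ≤ N := by
  have hN0 : (0 : ℝ) < N := by exact_mod_cast hN
  have h2 := Real.log_le_sub_one_of_pos hN0
  have h3 := Real.log_le_sub_one_of_pos (show (0 : ℝ) < N + 1 by linarith)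
  rw [cutoffCenter]
  linarith

lemma inv_le_cutoffWidth (hN : 1 ≤ N) : (8 * N : ℝ)⁻¹ ≤ cutoffWidth N := by
  have hN1 : (1 : ℝ) ≤ N := by exact_mod_cast hN
  have hN0 : (0 : ℝ) < N := by linarith
  have hlog := Real.one_sub_inv_le_log_of_pos (show (0 : ℝ) < (N + 1) / N by positivity)
  rw [Real.log_div (by positivity) hN0.ne'] at hlog
  calc (8 * N : ℝ)⁻¹ = (2 * N : ℝ)⁻¹ / 4 := by field_simp; norm_num
    _ ≤ (N + 1 : ℝ)⁻¹ / 4 := by gcongr; linarith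
    _ = (1 - ((N + 1 : ℝ) / N)⁻¹) / 4 := by field_simp; ring
    _ ≤ cutoffWidth N := by rw [cutoffWidth]; gcongr

lemma cutoffWidth_pos (hN : 1 ≤ N) : 0 < cutoffWidth N :=
  (inv_pos.2 (by positivity)).trans_le (inv_le_cutoffWidth hN)

lemma integrable_cutoffKernel (hN : 1 ≤ N) : Integrable (cutoffKernel N) :=
  integrable_fourier_trapezoid (cutoffCenter_nonneg N) (cutoffWidth_pos hN)

lemma fourierInv_cutoffKernel (hN : 1 ≤ N) {n : ℕ} (hn : 1 ≤ n) :
    𝓕⁻ (cutoffKernel N) (Real.log n) = if n ≤ N then 1 else 0 := by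
  have hn0 : (0 : ℝ) < n := by exact_mod_cast hn
  have habs : |Real.log n| = Real.log n := abs_of_nonneg (Real.log_natCast_nonneg n)
  have hδ := cutoffWidth_pos hN
  have hinv := fourierInv_fourier_trapezoid (x := Real.log n) (cutoffCenter_nonneg N) hδ
  rw [cutoffKernel]
  split_ifs with hle
  · have hlt : |Real.log n| < cutoffCenter N - cutoffWidth N := by
      have := Real.log_le_log hn0 (by exact_mod_cast hle : (n : ℝ) ≤ N)
      rw [cutoffWidth] at hδ
      rw [habs, cutoffCenter, cutoffWidth]
      linarith
    rw [hinv (.inl hlt), trapezoid_eq_one hδ hlt.le]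
  · have hlt : cutoffCenter N + cutoffWidth N < |Real.log n| := by
      have := Real.log_le_log (by positivity) (by exact_mod_cast not_le.1 hle : (N : ℝ) + 1 ≤ n)
      rw [cutoffWidth] at hδ
      rw [habs, cutoffCenter, cutoffWidth]
      linarith
    rw [hinv (.inr hlt), trapezoid_eq_zero hlt]

lemma exists_integral_norm_cutoffKernel_le {θ : ℝ} (h0 : 0 < θ) (h1 : θ ≤ 1) :
    ∃ C : ℝ, ∀ N : ℕ, 1 ≤ N → ∫ t, ‖cutoffKernel N t‖ ≤ C * (N : ℝ) ^ θ := by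
  refine ⟨Real.pi * ((2 * Real.pi) ^ θ + 8 ^ θ) *
    ∫ t : ℝ, min (|t| ^ (θ - 1)) (|t| ^ (-1 - θ)), fun N hN => ?_⟩
  have hδ := cutoffWidth_pos hN
  have hcenter : (2 * Real.pi * cutoffCenter N) ^ θ ≤ (2 * Real.pi) ^ θ * (N : ℝ) ^ θ := by
    rw [← Real.mul_rpow (by positivity) (by positivity)]
    have := cutoffCenter_nonneg N
    gcongr
    exact cutoffCenter_le hN
  have hwidth : (2 * Real.pi * cutoffWidth N) ^ (-θ) ≤ 8 ^ θ * (N : ℝ) ^ θ := by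
    rw [← Real.mul_rpow (by positivity) (by positivity), Real.rpow_neg (by positivity),
      ← Real.inv_rpow (by positivity)]
    gcongr
    refine inv_le_of_inv_le₀ (by positivity) ((inv_le_cutoffWidth hN).trans ?_)
    exact le_mul_of_one_le_left hδ.le (by linarith [Real.pi_gt_three])
  calc ∫ t, ‖cutoffKernel N t‖
      ≤ Real.pi * ((2 * Real.pi * cutoffCenter N) ^ θ + (2 * Real.pi * cutoffWidth N) ^ (-θ)) *
          ∫ t : ℝ, min (|t| ^ (θ - 1)) (|t| ^ (-1 - θ)) :=
        integral_norm_fourier_trapezoid_le (cutoffCenter_nonneg N) hδ h0 h1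
    _ ≤ Real.pi * ((2 * Real.pi) ^ θ * (N : ℝ) ^ θ + 8 ^ θ * (N : ℝ) ^ θ) *
          ∫ t : ℝ, min (|t| ^ (θ - 1)) (|t| ^ (-1 - θ)) := by gcongr
    _ = _ := by ring

end CutoffKernel

/-! ### Convolution along vertical lines -/

lemma isOpen_halfPlane (r : ℝ) : IsOpen (halfPlane r) :=
  isOpen_lt continuous_const Complex.continuous_re

lemma isPreconnected_halfPlane (r : ℝ) : IsPreconnected (halfPlane r) :=
  (convex_halfSpace_re_gt r).isPreconnected

lemma halfPlane_subset_halfPlane {r r' : ℝ} (h : r ≤ r') : halfPlane r' ⊆ halfPlane r :=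
  fun _ hs => lt_of_le_of_lt h hs

lemma closedBall_subset_halfPlane {s : ℂ} {ε r : ℝ} (h : ε + r < s.re) :
    Metric.closedBall s r ⊆ halfPlane ε := by
  intro z hz
  have hre : |(z - s).re| ≤ r :=
    (Complex.abs_re_le_norm _).trans (by rwa [Metric.mem_closedBall, dist_eq_norm] at hz)
  rw [Complex.sub_re, abs_le] at hre
  change ε < z.re
  linarith [hre.1]

lemma norm_deriv_le_of_bounded_halfPlane {F : ℂ → ℂ} {ε M r : ℝ}
    (hF : DifferentiableOn ℂ F (halfPlane ε)) (hM : ∀ s ∈ halfPlane ε, ‖F s‖ ≤ M) (hr : 0 < r)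
    {s : ℂ} (hs : ε + r < s.re) : ‖deriv F s‖ ≤ M / r := by
  have hsub := closedBall_subset_halfPlane hs
  refine Complex.norm_deriv_le_of_forall_mem_sphere_norm_le hr ?_
    fun z hz => hM z (hsub (Metric.sphere_subset_closedBall hz))
  exact (hF.mono (Metric.closure_ball_subset_closedBall.trans hsub)).diffContOnCl

lemma partialSum_zero (a : ArithmeticFunction ℂ) (s : ℂ) : partialSum a s 0 = 0 := by
  simp [partialSum]

lemma partialSum_eq_sum_term (a : ArithmeticFunction ℂ) (s : ℂ) (N : ℕ) :
    partialSum a s N = ∑ n ∈ Finset.range (N + 1), LSeries.term a s n := by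
  rw [Finset.sum_range_succ', LSeries.term_zero, add_zero, partialSum,
    Finset.range_eq_Ico, Finset.sum_Ico_add' (fun n => LSeries.term a s n) 0 N 1]
  refine Finset.sum_congr rfl fun n hn => ?_
  rw [LSeries.term_of_ne_zero (Nat.one_le_iff_ne_zero.1 (Finset.mem_Icc.1 hn).1),
    Complex.cpow_neg, div_eq_mul_inv]

lemma hasDerivAt_partialSum (a : ArithmeticFunction ℂ) (N : ℕ) (s : ℂ) :
    HasDerivAt (fun s => partialSum a s N) (partialSum (D a) s N) s := by
  simp only [partialSum_eq_sum_term]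
  refine HasDerivAt.fun_sum fun n _ => (LSeries.hasDerivAt_term a n s).congr_deriv ?_
  rcases eq_or_ne n 0 with rfl | hn
  · simp
  · rw [LSeries.term_of_ne_zero hn, LSeries.term_of_ne_zero hn, LSeries.logMul, ← neg_div]
    change -(Complex.log n * a n) / _ = -(a n * (Real.log n : ℂ)) / _
    rw [Complex.natCast_log, mul_comm]

lemma differentiable_partialSum (a : ArithmeticFunction ℂ) (N : ℕ) :
    Differentiable ℂ fun s => partialSum a s N :=
  fun s => (hasDerivAt_partialSum a N s).differentiableAt

/-- The convolution of `F` with the kernel `k` along vertical lines. The scaling of the imaginary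
axis by `2π` makes it multiply the `n`-th term of a Dirichlet series by the inverse Fourier
transform of `k` at `log n`, see `hasSum_verticalConv`. -/
def verticalConv (k : ℝ → ℂ) (F : ℂ → ℂ) (s : ℂ) : ℂ :=
  ∫ t, k t * F (s - 2 * Real.pi * t * Complex.I)

section VerticalConv

variable {a : ArithmeticFunction ℂ} {F : ℂ → ℂ} {k : ℝ → ℂ} {ε M : ℝ} {s : ℂ}

lemma sub_vertical_re (s : ℂ) (t : ℝ) : (s - 2 * Real.pi * t * Complex.I).re = s.re := by
  simp

lemma sub_vertical_mem_halfPlane (hs : s ∈ halfPlane ε) (t : ℝ) :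
    s - 2 * Real.pi * t * Complex.I ∈ halfPlane ε :=
  (show ε < s.re from hs).trans_eq (sub_vertical_re s t).symm

lemma norm_mul_comp_sub_vertical_le (hM : ∀ s ∈ halfPlane ε, ‖F s‖ ≤ M) (hs : s ∈ halfPlane ε)
    (t : ℝ) : ‖k t * F (s - 2 * Real.pi * t * Complex.I)‖ ≤ ‖k t‖ * M := by
  rw [norm_mul]
  gcongr
  exact hM _ (sub_vertical_mem_halfPlane hs t)

lemma norm_verticalConv_le (hM : ∀ s ∈ halfPlane ε, ‖F s‖ ≤ M) (hk : Integrable k)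
    (hs : s ∈ halfPlane ε) : ‖verticalConv k F s‖ ≤ (∫ t, ‖k t‖) * M := by
  rw [← integral_mul_const]
  exact norm_integral_le_of_norm_le (hk.norm.mul_const M)
    (Eventually.of_forall (norm_mul_comp_sub_vertical_le hM hs))

lemma aestronglyMeasurable_mul_comp_sub_vertical (hF : ContinuousOn F (halfPlane ε))
    (hk : Integrable k) (hs : s ∈ halfPlane ε) :
    AEStronglyMeasurable fun t : ℝ => k t * F (s - 2 * Real.pi * t * Complex.I) :=
  hk.aestronglyMeasurable.mul (hF.comp_continuous (by fun_prop)
    (sub_vertical_mem_halfPlane hs)).aestronglyMeasurable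

lemma differentiableOn_verticalConv (hF : DifferentiableOn ℂ F (halfPlane ε))
    (hM : ∀ s ∈ halfPlane ε, ‖F s‖ ≤ M) (hk : Integrable k) :
    DifferentiableOn ℂ (verticalConv k F) (halfPlane ε) := by
  intro s₀ hs₀
  obtain ⟨r, hr0, hr⟩ : ∃ r > 0, ε + 2 * r < s₀.re :=
    ⟨(s₀.re - ε) / 3, div_pos (sub_pos.2 hs₀) three_pos, by linarith [show ε < s₀.re from hs₀]⟩
  have hball : Metric.ball s₀ r ⊆ halfPlane (ε + r) :=
    Metric.ball_subset_closedBall.trans (closedBall_subset_halfPlane (by linarith))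
  have hmem : ∀ s ∈ Metric.ball s₀ r, s ∈ halfPlane ε := fun s hs =>
    halfPlane_subset_halfPlane (by linarith) (hball hs)
  have hderiv : ∀ t : ℝ, ∀ s ∈ Metric.ball s₀ r,
      HasDerivAt (fun s => k t * F (s - 2 * Real.pi * t * Complex.I))
        (k t * deriv F (s - 2 * Real.pi * t * Complex.I)) s := fun t s hs =>
    have ht := sub_vertical_mem_halfPlane (hmem s hs) t
    (HasDerivAt.comp_sub_const s _ (hF.differentiableAt
      ((isOpen_halfPlane ε).mem_nhds ht)).hasDerivAt).const_mul (k t)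
  have hbound : ∀ t : ℝ, ∀ s ∈ Metric.ball s₀ r,
      ‖k t * deriv F (s - 2 * Real.pi * t * Complex.I)‖ ≤ ‖k t‖ * (M / r) := fun t s hs =>
    norm_mul_comp_sub_vertical_le
      (fun z hz => norm_deriv_le_of_bounded_halfPlane hF hM hr0 hz) (hball hs) t
  have hint : Integrable fun t : ℝ => k t * F (s₀ - 2 * Real.pi * t * Complex.I) :=
    (hk.norm.mul_const M).mono'
      (aestronglyMeasurable_mul_comp_sub_vertical hF.continuousOn hk hs₀)
      (Eventually.of_forall (norm_mul_comp_sub_vertical_le hM hs₀))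
  have hnhds := Metric.ball_mem_nhds s₀ hr0
  refine (hasDerivAt_integral_of_dominated_loc_of_deriv_le hnhds
    (by
      filter_upwards [hnhds] with s hs
      exact aestronglyMeasurable_mul_comp_sub_vertical hF.continuousOn hk (hmem s hs))
    hint (aestronglyMeasurable_mul_comp_sub_vertical
      (hF.deriv (isOpen_halfPlane ε)).continuousOn hk hs₀)
    (Eventually.of_forall hbound) (hk.norm.mul_const _)
    (Eventually.of_forall hderiv)).2.differentiableAt.differentiableWithinAt

lemma term_sub_vertical (a : ArithmeticFunction ℂ) (s : ℂ) (t : ℝ) (n : ℕ) :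
    LSeries.term a (s - 2 * Real.pi * t * Complex.I) n =
      LSeries.term a s n * Complex.exp (2 * Real.pi * t * Real.log n * Complex.I) := by
  rcases eq_or_ne n 0 with rfl | hn
  · simp
  · have hn' : (n : ℂ) ≠ 0 := by exact_mod_cast hn
    rw [LSeries.term_of_ne_zero hn, LSeries.term_of_ne_zero hn, Complex.cpow_sub _ _ hn',
      Complex.natCast_log, Complex.cpow_def_of_ne_zero hn' (2 * Real.pi * t * Complex.I),
      div_div_eq_mul_div, mul_div_right_comm]
    congr 2
    ring

lemma integral_mul_term_sub_vertical (k : ℝ → ℂ) (a : ArithmeticFunction ℂ) (s : ℂ) (n : ℕ) :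
    ∫ t, k t * LSeries.term a (s - 2 * Real.pi * t * Complex.I) n =
      LSeries.term a s n * 𝓕⁻ k (Real.log n) := by
  rw [Real.fourierInv_eq', ← integral_const_mul]
  congr 1
  funext t
  rw [term_sub_vertical, smul_eq_mul, RCLike.inner_apply, conj_trivial]
  push_cast
  ring_nf

lemma hasSum_verticalConv (hk : Integrable k)
    (hF : ∀ z : ℂ, z.re = s.re → LSeriesHasSum a z (F z)) :
    HasSum (fun n => LSeries.term a s n * 𝓕⁻ k (Real.log n)) (verticalConv k F s) := by
  have hnorm : ∀ (n : ℕ) (t : ℝ), ‖k t * LSeries.term a (s - 2 * Real.pi * t * Complex.I) n‖ =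
      ‖k t‖ * ‖LSeries.term a s n‖ := by
    intro n t
    rw [norm_mul, LSeries.norm_term_eq, LSeries.norm_term_eq, sub_vertical_re]
  have hint : ∀ n : ℕ, Integrable fun t : ℝ =>
      k t * LSeries.term a (s - 2 * Real.pi * t * Complex.I) n := by
    intro n
    refine (hk.norm.mul_const ‖LSeries.term a s n‖).mono' ?_
      (Eventually.of_forall fun t => (hnorm n t).le)
    simp only [term_sub_vertical]
    exact hk.aestronglyMeasurable.mul (by fun_prop)
  have hsummable : Summable fun n => ∫ t : ℝ,
      ‖k t * LSeries.term a (s - 2 * Real.pi * t * Complex.I) n‖ := by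
    simp only [hnorm, integral_mul_const]
    exact (hF s rfl).summable.norm.mul_left _
  have htsum : ∀ t : ℝ, ∑' n, k t * LSeries.term a (s - 2 * Real.pi * t * Complex.I) n =
      k t * F (s - 2 * Real.pi * t * Complex.I) := fun t =>
    (HasSum.mul_left (k t) (hF _ (sub_vertical_re s t))).tsum_eq
  have h := hasSum_integral_of_summable_integral_norm hint hsummable
  simp only [htsum, integral_mul_term_sub_vertical] at h
  exact h

lemma verticalConv_cutoffKernel {N : ℕ} (hN : 1 ≤ N)
    (hF : ∀ z : ℂ, z.re = s.re → LSeriesHasSum a z (F z)) :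
    verticalConv (cutoffKernel N) F s = partialSum a s N := by
  refine (hasSum_verticalConv (integrable_cutoffKernel hN) hF).unique ?_
  rw [partialSum_eq_sum_term]
  have hlow : ∀ n ∈ Finset.range (N + 1),
      LSeries.term a s n * 𝓕⁻ (cutoffKernel N) (Real.log n) = LSeries.term a s n := by
    intro n hn
    rcases Nat.eq_zero_or_pos n with rfl | hn0
    · simp
    · rw [fourierInv_cutoffKernel hN hn0, if_pos (Finset.mem_range_succ_iff.1 hn), mul_one]
  have hhigh : ∀ n ∉ Finset.range (N + 1),
      LSeries.term a s n * 𝓕⁻ (cutoffKernel N) (Real.log n) = 0 := by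
    intro n hn
    rw [Finset.mem_range_succ_iff] at hn
    rw [fourierInv_cutoffKernel hN (by omega), if_neg hn, mul_zero]
  rw [← Finset.sum_congr rfl hlow]
  exact hasSum_sum_of_ne_finset_zero hhigh

end VerticalConv

/-- `F` is a holomorphic extension to the half-plane `Re s > ε`, bounded there by `M`, of the sum
of a Dirichlet series that is only assumed to converge absolutely on some half-plane. -/
structure IsBoundedExtension (a : ArithmeticFunction ℂ) (F : ℂ → ℂ) (ε M : ℝ) : Prop where
  differentiableOn : DifferentiableOn ℂ F (halfPlane ε)
  norm_le : ∀ s ∈ halfPlane ε, ‖F s‖ ≤ M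
  exists_hasSum : ∃ σ, ∀ s ∈ halfPlane σ, LSeriesHasSum a s (F s)

namespace IsBoundedExtension

variable {a b : ArithmeticFunction ℂ} {F G : ℂ → ℂ} {ε M M' : ℝ}

lemma bound_nonneg (h : IsBoundedExtension a F ε M) : 0 ≤ M := by
  obtain ⟨z, hz⟩ := halfPlane_nonempty ε
  exact (norm_nonneg _).trans (h.norm_le z hz)

lemma mul (hF : IsBoundedExtension a F ε M) (hG : IsBoundedExtension b G ε M') :
    IsBoundedExtension (a * b) (F * G) ε (M * M') := by
  obtain ⟨σ, hσ⟩ := hF.exists_hasSum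
  obtain ⟨τ, hτ⟩ := hG.exists_hasSum
  refine ⟨hF.differentiableOn.mul hG.differentiableOn, fun s hs => ?_, max σ τ, fun s hs => ?_⟩
  · rw [Pi.mul_apply, norm_mul]
    exact mul_le_mul (hF.norm_le s hs) (hG.norm_le s hs) (norm_nonneg _) hF.bound_nonneg
  · exact ArithmeticFunction.LSeriesHasSum_mul
      (hσ s (halfPlane_subset_halfPlane (le_max_left σ τ) hs))
      (hτ s (halfPlane_subset_halfPlane (le_max_right σ τ) hs))

lemma norm_partialSum_le_integral (h : IsBoundedExtension a F ε M) {N : ℕ} (hN : 1 ≤ N) {s : ℂ}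
    (hs : s ∈ halfPlane ε) : ‖partialSum a s N‖ ≤ (∫ t, ‖cutoffKernel N t‖) * M := by
  have hk := integrable_cutoffKernel hN
  obtain ⟨σ, hσ⟩ := h.exists_hasSum
  obtain ⟨z, hz⟩ := halfPlane_nonempty (max ε σ)
  have hconv : Set.EqOn (verticalConv (cutoffKernel N) F) (fun s => partialSum a s N)
      (halfPlane ε) := by
    refine ((differentiableOn_verticalConv h.differentiableOn h.norm_le hk).analyticOnNhd
      (isOpen_halfPlane ε)).eqOn_of_preconnected_of_eventuallyEq
      ((differentiable_partialSum a N).differentiableOn.analyticOnNhd (isOpen_halfPlane ε))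
      (isPreconnected_halfPlane ε) (halfPlane_subset_halfPlane (le_max_left ε σ) hz) ?_
    filter_upwards [(isOpen_halfPlane σ).mem_nhds
      (halfPlane_subset_halfPlane (le_max_right ε σ) hz)] with s hs
    exact verticalConv_cutoffKernel hN fun w hw => hσ w (hs.trans_eq hw.symm)
  exact (congrArg norm (hconv hs)).ge.trans (norm_verticalConv_le h.norm_le hk hs)

end IsBoundedExtension

/-! ### Partial summation -/

section PartialSummation

variable {a : ArithmeticFunction ℂ} {s : ℂ} {S : Set ℂ} {C θ δ : ℝ}

lemma term_eq_rpow_smul_term (a : ArithmeticFunction ℂ) (s : ℂ) (δ : ℝ) (n : ℕ) :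
    LSeries.term a s n = ((n : ℝ) ^ (-δ)) • LSeries.term a (s - δ) n := by
  rcases eq_or_ne n 0 with rfl | hn
  · simp
  · have hn' : (n : ℂ) ≠ 0 := by exact_mod_cast hn
    have hpow : (n : ℂ) ^ (δ : ℂ) ≠ 0 := by simp [hn']
    rw [LSeries.term_of_ne_zero hn, LSeries.term_of_ne_zero hn, Complex.cpow_sub _ _ hn',
      Complex.real_smul, Complex.ofReal_cpow n.cast_nonneg, Complex.ofReal_neg,
      Complex.ofReal_natCast, Complex.cpow_neg]
    field_simp

lemma partialSum_by_parts (a : ArithmeticFunction ℂ) (s : ℂ) (δ : ℝ) (N : ℕ) :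
    partialSum a s N = ((N : ℝ) ^ (-δ)) • partialSum a (s - δ) N +
      ∑ n ∈ Finset.range N,
        ((n : ℝ) ^ (-δ) - ((n + 1 : ℕ) : ℝ) ^ (-δ)) • partialSum a (s - δ) n := by
  simp only [partialSum_eq_sum_term, term_eq_rpow_smul_term a s δ]
  rw [Finset.sum_range_by_parts, Nat.add_sub_cancel, sub_eq_add_neg, ← Finset.sum_neg_distrib]
  simp only [← neg_smul, neg_sub]

lemma one_sub_mul_le_one_add_rpow_neg {x : ℝ} (hx : 0 ≤ x) (hδ : 0 ≤ δ) :
    1 - δ * x ≤ (1 + x) ^ (-δ) := by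
  have hlog : δ * Real.log (1 + x) ≤ δ * x := by
    gcongr
    linarith [Real.log_le_sub_one_of_pos (show 0 < 1 + x by linarith)]
  calc 1 - δ * x ≤ Real.log (1 + x) * -δ + 1 := by linarith
    _ ≤ (1 + x) ^ (-δ) := by
      rw [Real.rpow_def_of_pos (by linarith)]
      exact Real.add_one_le_exp _

lemma abs_rpow_neg_sub_rpow_neg_le (hδ : 0 ≤ δ) {n : ℕ} (hn : 1 ≤ n) :
    |(n : ℝ) ^ (-δ) - ((n + 1 : ℕ) : ℝ) ^ (-δ)| ≤ δ * (n : ℝ) ^ (-δ - 1) := by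
  have hn0 : (0 : ℝ) < n := by exact_mod_cast hn
  have hanti : ((n + 1 : ℕ) : ℝ) ^ (-δ) ≤ (n : ℝ) ^ (-δ) :=
    Real.rpow_le_rpow_of_nonpos hn0 (by simp) (by linarith)
  have hsucc : ((n + 1 : ℕ) : ℝ) ^ (-δ) = (n : ℝ) ^ (-δ) * (1 + 1 / (n : ℝ)) ^ (-δ) := by
    rw [← Real.mul_rpow hn0.le (by positivity), mul_add, mul_one, mul_one_div_cancel hn0.ne',
      Nat.cast_succ]
  rw [abs_of_nonneg (sub_nonneg.2 hanti), hsucc, Real.rpow_sub_one hn0.ne']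
  calc (n : ℝ) ^ (-δ) - (n : ℝ) ^ (-δ) * (1 + 1 / (n : ℝ)) ^ (-δ)
      ≤ (n : ℝ) ^ (-δ) - (n : ℝ) ^ (-δ) * (1 - δ * (1 / n)) := by
        gcongr
        exact one_sub_mul_le_one_add_rpow_neg (by positivity) hδ
    _ = δ * ((n : ℝ) ^ (-δ) / n) := by ring

lemma norm_rpow_smul_partialSum_le
    (ha : ∀ n : ℕ, 1 ≤ n → ‖partialSum a (s - δ) n‖ ≤ C * (n : ℝ) ^ θ) {n : ℕ} (hn : 1 ≤ n) :
    ‖((n : ℝ) ^ (-δ)) • partialSum a (s - δ) n‖ ≤ C * (n : ℝ) ^ (-(δ - θ)) := by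
  have hn0 : (0 : ℝ) < n := by exact_mod_cast hn
  rw [norm_smul, Real.norm_of_nonneg (by positivity)]
  calc (n : ℝ) ^ (-δ) * ‖partialSum a (s - δ) n‖
      ≤ (n : ℝ) ^ (-δ) * (C * (n : ℝ) ^ θ) := by
        gcongr
        exact ha n hn
    _ = C * (n : ℝ) ^ (-(δ - θ)) := by
        rw [show -(δ - θ) = -δ + θ by ring, Real.rpow_add hn0]
        ring

lemma norm_rpow_sub_smul_partialSum_le (hδ : 0 ≤ δ)
    (ha : ∀ n : ℕ, 1 ≤ n → ‖partialSum a (s - δ) n‖ ≤ C * (n : ℝ) ^ θ) (n : ℕ) :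
    ‖((n : ℝ) ^ (-δ) - ((n + 1 : ℕ) : ℝ) ^ (-δ)) • partialSum a (s - δ) n‖ ≤
      C * (δ * (n : ℝ) ^ (θ - δ - 1)) := by
  rcases Nat.eq_zero_or_pos n with rfl | hn
  · have hC : 0 ≤ C := by simpa using (norm_nonneg _).trans (ha 1 le_rfl)
    rw [partialSum_zero, smul_zero, norm_zero]
    positivity
  · have hn0 : (0 : ℝ) < n := by exact_mod_cast hn
    rw [norm_smul, Real.norm_eq_abs]
    calc |(n : ℝ) ^ (-δ) - ((n + 1 : ℕ) : ℝ) ^ (-δ)| * ‖partialSum a (s - δ) n‖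
        ≤ δ * (n : ℝ) ^ (-δ - 1) * (C * (n : ℝ) ^ θ) := by
          gcongr
          · exact abs_rpow_neg_sub_rpow_neg_le hδ hn
          · exact ha n hn
      _ = C * (δ * (n : ℝ) ^ (θ - δ - 1)) := by
          rw [show θ - δ - 1 = -δ - 1 + θ by ring, Real.rpow_add hn0]
          ring

lemma summable_mul_rpow_sub_sub_one (hδ : θ < δ) :
    Summable fun n : ℕ => δ * (n : ℝ) ^ (θ - δ - 1) :=
  (Real.summable_nat_rpow.2 (by linarith)).mul_left δ

lemma norm_partialSum_le_of_le_rpow (hδ₀ : 0 ≤ δ) (hδ : θ < δ)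
    (ha : ∀ n : ℕ, 1 ≤ n → ‖partialSum a (s - δ) n‖ ≤ C * (n : ℝ) ^ θ) (N : ℕ) :
    ‖partialSum a s N‖ ≤ C * (1 + ∑' n : ℕ, δ * (n : ℝ) ^ (θ - δ - 1)) := by
  have hC : 0 ≤ C := by simpa using (norm_nonneg _).trans (ha 1 le_rfl)
  have hu : ∀ n : ℕ, 0 ≤ δ * (n : ℝ) ^ (θ - δ - 1) := fun n => by positivity
  rcases Nat.eq_zero_or_pos N with rfl | hN
  · rw [partialSum_zero, norm_zero]
    exact mul_nonneg hC (add_nonneg zero_le_one (tsum_nonneg hu))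
  have hboundary : ‖((N : ℝ) ^ (-δ)) • partialSum a (s - δ) N‖ ≤ C * 1 := by
    refine (norm_rpow_smul_partialSum_le ha hN).trans ?_
    gcongr
    exact Real.rpow_le_one_of_one_le_of_nonpos (by exact_mod_cast hN) (by linarith)
  rw [partialSum_by_parts a s δ N, mul_add, ← tsum_mul_left]
  refine norm_add_le_of_le hboundary ((norm_sum_le_of_le _ fun n _ =>
    norm_rpow_sub_smul_partialSum_le hδ₀ ha n).trans ?_)
  exact ((summable_mul_rpow_sub_sub_one hδ).mul_left C).sum_le_tsum _
    fun n _ => mul_nonneg hC (hu n)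

lemma tendstoUniformlyOn_partialSum_of_le_rpow (hδ₀ : 0 ≤ δ) (hδ : θ < δ)
    (ha : ∀ s ∈ S, ∀ n : ℕ, 1 ≤ n → ‖partialSum a (s - δ) n‖ ≤ C * (n : ℝ) ^ θ) :
    TendstoUniformlyOn (fun N s => partialSum a s N) (value a) atTop S := by
  have hboundary : TendstoUniformlyOn
      (fun (N : ℕ) (s : ℂ) => ((N : ℝ) ^ (-δ)) • partialSum a (s - δ) N) 0 atTop S := by
    rw [Metric.tendstoUniformlyOn_iff]
    intro η hη
    have hlim : Tendsto (fun n : ℕ => C * (n : ℝ) ^ (-(δ - θ))) atTop (𝓝 0) := by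
      simpa using ((tendsto_rpow_neg_atTop (sub_pos.2 hδ)).comp
        tendsto_natCast_atTop_atTop).const_mul C
    filter_upwards [hlim.eventually_lt_const hη, eventually_ge_atTop 1] with N hN hN1 s hs
    rw [Pi.zero_apply, dist_zero_left]
    exact (norm_rpow_smul_partialSum_le (ha s hs) hN1).trans_lt hN
  have hsum := tendstoUniformlyOn_tsum_nat ((summable_mul_rpow_sub_sub_one hδ).mul_left C)
    fun n s hs => norm_rpow_sub_smul_partialSum_le hδ₀ (ha s hs) n
  have hlim := (hboundary.add hsum).congr (F' := fun N s => partialSum a s N)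
    (Eventually.of_forall fun N s _ => (partialSum_by_parts a s δ N).symm)
  exact hlim.congr_right fun s hs => ((hlim.tendsto_at hs).limUnder_eq).symm

lemma norm_sum_range_smul_le_of_antitone {E : Type*} [NormedAddCommGroup E] [NormedSpace ℝ E]
    {w : ℕ → ℝ} {z : ℕ → E} {K : ℝ} (hw : Antitone w) (hw0 : ∀ n, 0 ≤ w n)
    (hz : ∀ n, ‖∑ i ∈ Finset.range n, z i‖ ≤ K) (N : ℕ) :
    ‖∑ i ∈ Finset.range N, w i • z i‖ ≤ w 0 * K := by
  have hdiff : ∀ n, ‖(w (n + 1) - w n) • ∑ i ∈ Finset.range (n + 1), z i‖ ≤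
      (w n - w (n + 1)) * K := by
    intro n
    rw [norm_smul, Real.norm_eq_abs, abs_sub_comm, abs_of_nonneg (sub_nonneg.2 (hw n.le_succ))]
    exact mul_le_mul_of_nonneg_left (hz _) (sub_nonneg.2 (hw n.le_succ))
  calc ‖∑ i ∈ Finset.range N, w i • z i‖
      ≤ w (N - 1) * K + ∑ i ∈ Finset.range (N - 1), (w i - w (i + 1)) * K := by
        rw [Finset.sum_range_by_parts]
        refine norm_sub_le_of_le ?_ (norm_sum_le_of_le _ fun i _ => hdiff i)
        rw [norm_smul, Real.norm_of_nonneg (hw0 _)]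
        exact mul_le_mul_of_nonneg_left (hz N) (hw0 _)
    _ = w 0 * K := by
        rw [← Finset.sum_mul, Finset.sum_range_sub']
        ring

end PartialSummation

lemma sub_ofReal_mem_halfPlane {s : ℂ} {ε δ : ℝ} (hs : s ∈ halfPlane (ε + δ)) :
    s - δ ∈ halfPlane ε := by
  change ε < (s - δ).re
  rw [Complex.sub_re, Complex.ofReal_re]
  exact lt_sub_iff_add_lt.2 hs

/-- Bohr's theorem in a quantitative form: `L` depends neither on the series nor on `ε`. -/
theorem IsBoundedExtension.exists_norm_partialSum_le {δ : ℝ} (hδ : 0 < δ) :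
    ∃ L : ℝ, ∀ {a : ArithmeticFunction ℂ} {F : ℂ → ℂ} {ε M : ℝ},
      IsBoundedExtension a F ε M →
      ∀ s ∈ halfPlane (ε + δ), ∀ N : ℕ, ‖partialSum a s N‖ ≤ L * M := by
  obtain ⟨θ, hθ0, hθ⟩ := exists_between (lt_min hδ one_pos)
  obtain ⟨hθδ, hθ1⟩ := lt_min_iff.1 hθ
  obtain ⟨K, hK⟩ := exists_integral_norm_cutoffKernel_le hθ0 hθ1.le
  refine ⟨K * (1 + ∑' n : ℕ, δ * (n : ℝ) ^ (θ - δ - 1)),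
    fun {a F ε M} h s hs N => ?_⟩
  have hgrowth : ∀ n : ℕ, 1 ≤ n → ‖partialSum a (s - δ) n‖ ≤ K * M * (n : ℝ) ^ θ := by
    intro n hn
    calc ‖partialSum a (s - δ) n‖ ≤ (∫ t, ‖cutoffKernel n t‖) * M :=
          h.norm_partialSum_le_integral hn (sub_ofReal_mem_halfPlane hs)
      _ ≤ K * (n : ℝ) ^ θ * M := mul_le_mul_of_nonneg_right (hK n hn) h.bound_nonneg
      _ = K * M * (n : ℝ) ^ θ := by ring
  exact (norm_partialSum_le_of_le_rpow hδ.le hθδ hgrowth N).trans_eq (by ring)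

/-! ### Dirichlet series with bounded partial sums -/

/-- The partial sums are bounded on each half-plane `Re s > ε`, `ε > 0`. This is the description
of `HInfPlus` in terms of coefficients alone, see `mem_HInfPlus_iff_hasBoundedPartialSums`. -/
def HasBoundedPartialSums (a : ArithmeticFunction ℂ) : Prop :=
  ∀ ε : ℝ, 0 < ε → ∃ C : ℝ, ∀ s ∈ halfPlane ε, ∀ N : ℕ, ‖partialSum a s N‖ ≤ C

namespace HasBoundedPartialSums

variable {a : ArithmeticFunction ℂ}

lemma tendstoUniformlyOn (ha : HasBoundedPartialSums a) {ε : ℝ} (hε : 0 < ε) :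
    TendstoUniformlyOn (fun N s => partialSum a s N) (value a) atTop (halfPlane ε) := by
  obtain ⟨C, hC⟩ := ha (ε / 2) (half_pos hε)
  refine tendstoUniformlyOn_partialSum_of_le_rpow (C := C) (half_pos hε).le (half_pos hε)
    fun s hs n _ => ?_
  rw [Real.rpow_zero, mul_one]
  exact hC _ (sub_ofReal_mem_halfPlane (by rwa [add_halves])) n

lemma tendstoLocallyUniformlyOn (ha : HasBoundedPartialSums a) :
    TendstoLocallyUniformlyOn (fun N s => partialSum a s N) (value a) atTop (halfPlane 0) :=
  tendstoLocallyUniformlyOn_of_forall_exists_nhds fun s (hs : 0 < s.re) =>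
    ⟨halfPlane (s.re / 2), mem_nhdsWithin_of_mem_nhds
      ((isOpen_halfPlane _).mem_nhds (half_lt_self hs)), ha.tendstoUniformlyOn (half_pos hs)⟩

lemma mem_HInfPlus (ha : HasBoundedPartialSums a) : a ∈ HInfPlus := by
  have hlim := ha.tendstoLocallyUniformlyOn
  refine ⟨fun s hs => ⟨_, hlim.tendsto_at hs⟩, ?_, fun ε hε => ?_⟩
  · exact hlim.differentiableOn
      (Eventually.of_forall fun N => (differentiable_partialSum a N).differentiableOn)
      (isOpen_halfPlane 0)
  · obtain ⟨C, hC⟩ := ha ε hε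
    exact ⟨C, fun s hs => le_of_tendsto (hlim.tendsto_at (hε.trans hs)).norm
      (Eventually.of_forall (hC s hs))⟩

lemma D (ha : HasBoundedPartialSums a) : HasBoundedPartialSums (D a) := by
  intro ε hε
  obtain ⟨C, hC⟩ := ha (ε / 2) (half_pos hε)
  refine ⟨C / (ε / 2), fun s hs N => ?_⟩
  rw [← (hasDerivAt_partialSum a N s).deriv]
  exact norm_deriv_le_of_bounded_halfPlane (differentiable_partialSum a N).differentiableOn
    (fun z hz => hC z hz N) (half_pos hε) (by rwa [add_halves])

end HasBoundedPartialSums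

namespace ConvergesAt

variable {a : ArithmeticFunction ℂ} {s s₀ : ℂ}

lemma exists_norm_coeff_le (h : ConvergesAt a s₀) :
    ∃ C : ℝ, ∀ n : ℕ, n ≠ 0 → ‖a n‖ ≤ C * (n : ℝ) ^ s₀.re := by
  obtain ⟨C, hC⟩ := h.tendsto.norm.bddAbove_range
  refine ⟨C + C, fun n hn => ?_⟩
  obtain ⟨m, rfl⟩ := Nat.exists_eq_succ_of_ne_zero hn
  have hterm : LSeries.term a s₀ (m + 1) = partialSum a s₀ (m + 1) - partialSum a s₀ m := by
    rw [partialSum_eq_sum_term, partialSum_eq_sum_term, Finset.sum_range_succ, add_sub_cancel_left]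
  rw [← div_le_iff₀ (by positivity)]
  calc ‖a (m + 1)‖ / ((m + 1 : ℕ) : ℝ) ^ s₀.re = ‖LSeries.term a s₀ (m + 1)‖ := by
        rw [LSeries.norm_term_eq, if_neg hn]
    _ ≤ C + C := by
        rw [hterm]
        exact norm_sub_le_of_le (hC ⟨m + 1, rfl⟩) (hC ⟨m, rfl⟩)

lemma lseriesHasSum_value (h : ConvergesAt a s₀) (hs : s₀.re + 1 < s.re) :
    LSeriesHasSum a s (value a s) := by
  obtain ⟨C, hC⟩ := h.exists_norm_coeff_le
  have hsummable : LSeriesSummable a s :=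
    LSeriesSummable_of_le_const_mul_rpow hs ⟨C, by simpa only [add_sub_cancel_right] using hC⟩
  have hlim : Tendsto (partialSum a s) atTop (𝓝 (∑' n, LSeries.term a s n)) :=
    (hsummable.hasSum.tendsto_sum_nat.comp (tendsto_add_atTop_nat 1)).congr
      fun N => (partialSum_eq_sum_term a s N).symm
  rw [LSeriesHasSum, value, hlim.limUnder_eq]
  exact hsummable.hasSum

end ConvergesAt

lemma norm_value_le_supSeminorm (f : HInfPlus) (ε : {ε : ℝ // 0 < ε}) {s : ℂ}
    (hs : s ∈ halfPlane ε) : ‖value f.1 s‖ ≤ supSeminorm ε f :=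
  le_ciSup (HInfPlus.bddAbove f ε.2) ⟨s, hs⟩

lemma supSeminorm_le_of_norm_partialSum_le (f : HInfPlus) (ε : {ε : ℝ // 0 < ε}) {C : ℝ}
    (hC : ∀ s ∈ halfPlane ε, ∀ N : ℕ, ‖partialSum f.1 s N‖ ≤ C) : supSeminorm ε f ≤ C := by
  have := halfPlane_nonempty ε
  exact ciSup_le fun s => le_of_tendsto (HInfPlus.convergesAt f ε.2 s).tendsto.norm
    (Eventually.of_forall (hC s s.2))

lemma HInfPlus.isBoundedExtension (f : HInfPlus) (ε : {ε : ℝ // 0 < ε}) :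
    IsBoundedExtension f.1 (value f.1) ε (supSeminorm ε f) where
  differentiableOn := f.2.2.1.mono (halfPlane_subset_halfPlane ε.2.le)
  norm_le _ hs := norm_value_le_supSeminorm f ε hs
  exists_hasSum := ⟨2, fun s (hs : 2 < s.re) =>
    (f.2.1 1 (by simp [halfPlane])).lseriesHasSum_value (by norm_num [hs])⟩

lemma HInfPlus.hasBoundedPartialSums {f : ArithmeticFunction ℂ} (hf : f ∈ HInfPlus) :
    HasBoundedPartialSums f := by
  intro ε hε
  obtain ⟨L, hL⟩ := IsBoundedExtension.exists_norm_partialSum_le (half_pos hε)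
  refine ⟨_, fun s hs => hL (HInfPlus.isBoundedExtension ⟨f, hf⟩ ⟨ε / 2, half_pos hε⟩) s ?_⟩
  rwa [add_halves]

theorem mem_HInfPlus_iff_hasBoundedPartialSums {f : ArithmeticFunction ℂ} :
    f ∈ HInfPlus ↔ HasBoundedPartialSums f :=
  ⟨HInfPlus.hasBoundedPartialSums, HasBoundedPartialSums.mem_HInfPlus⟩

lemma D_mem_HInfPlus {g : ArithmeticFunction ℂ} (hg : g ∈ HInfPlus) : D g ∈ HInfPlus :=
  mem_HInfPlus_iff_hasBoundedPartialSums.2 (HInfPlus.hasBoundedPartialSums hg).D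

lemma one_mem_HInfPlus : (1 : ArithmeticFunction ℂ) ∈ HInfPlus := by
  refine mem_HInfPlus_iff_hasBoundedPartialSums.2 fun ε _ => ⟨1, fun s _ N => ?_⟩
  rcases Nat.eq_zero_or_pos N with rfl | hN
  · simp [partialSum_zero]
  · rw [partialSum, Finset.sum_eq_single_of_mem 1 (Finset.mem_Icc.2 ⟨le_rfl, hN⟩)
      fun n _ hn => by rw [ArithmeticFunction.one_apply_ne hn, zero_mul]]
    simp

/-! ### The Volterra operator -/

lemma term_J {b : ArithmeticFunction ℂ} (hb : b 1 = 0) (s : ℂ) (n : ℕ) :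
    LSeries.term (J b) s n = -((Real.log (max n 2 : ℕ))⁻¹ • LSeries.term b s n) := by
  rcases eq_or_ne n 0 with rfl | hn0
  · simp
  rw [LSeries.term_of_ne_zero hn0, LSeries.term_of_ne_zero hn0, Complex.real_smul]
  change (if 2 ≤ n then -(b n / (Real.log n : ℂ)) else 0) / _ = _
  split_ifs with hn
  · rw [max_eq_left hn]
    push_cast
    ring
  · obtain rfl : n = 1 := by omega
    simp [hb]

lemma norm_partialSum_J_le {b : ArithmeticFunction ℂ} (hb : b 1 = 0) {s : ℂ} {K : ℝ}
    (hK : ∀ N, ‖partialSum b s N‖ ≤ K) (N : ℕ) :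
    ‖partialSum (J b) s N‖ ≤ (Real.log 2)⁻¹ * K := by
  have hlog : ∀ n : ℕ, 0 < Real.log (max n 2 : ℕ) := fun n =>
    Real.log_pos (by exact_mod_cast le_max_right n 2)
  have hanti : Antitone fun n : ℕ => (Real.log (max n 2 : ℕ))⁻¹ := fun m n hmn =>
    inv_anti₀ (hlog m) (Real.log_le_log (by positivity)
      (by exact_mod_cast max_le_max_right 2 hmn))
  have hsum : ∀ n, ‖∑ i ∈ Finset.range n, LSeries.term b s i‖ ≤ K := by
    rintro (_ | n)
    · simpa using (norm_nonneg _).trans (hK 0)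
    · exact partialSum_eq_sum_term b s n ▸ hK n
  simp only [partialSum_eq_sum_term, term_J hb, Finset.sum_neg_distrib, norm_neg]
  simpa only [zero_le, max_eq_right, Nat.cast_ofNat] using
    norm_sum_range_smul_le_of_antitone hanti (fun n => (inv_pos.2 (hlog n)).le) hsum (N + 1)

lemma exists_norm_partialSum_volterra_le {δ : ℝ} (hδ : 0 < δ) :
    ∃ L : ℝ, ∀ {g f : ArithmeticFunction ℂ} {G F : ℂ → ℂ} {ε M M' : ℝ},
      IsBoundedExtension (D g) G ε M → IsBoundedExtension f F ε M' →
      ∀ s ∈ halfPlane (ε + δ), ∀ N : ℕ, ‖partialSum (volterra g f) s N‖ ≤ L * (M * M') := by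
  obtain ⟨L, hL⟩ := IsBoundedExtension.exists_norm_partialSum_le hδ
  refine ⟨(Real.log 2)⁻¹ * L, fun {g f _ _ _ _ _} hg hf s hs N => ?_⟩
  rw [mul_assoc]
  exact norm_partialSum_J_le (D_mul_apply_one g f) (hL (hg.mul hf) s hs) N

lemma volterra_mem_HInfPlus {g f : ArithmeticFunction ℂ} (hg : g ∈ HInfPlus)
    (hf : f ∈ HInfPlus) : volterra g f ∈ HInfPlus := by
  refine mem_HInfPlus_iff_hasBoundedPartialSums.2 fun ε hε => ?_
  obtain ⟨L, hL⟩ := exists_norm_partialSum_volterra_le (half_pos hε)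
  refine ⟨_, fun s hs => hL
    (HInfPlus.isBoundedExtension ⟨D g, D_mem_HInfPlus hg⟩ ⟨ε / 2, half_pos hε⟩)
    (HInfPlus.isBoundedExtension ⟨f, hf⟩ ⟨ε / 2, half_pos hε⟩) s ?_⟩
  rwa [add_halves]

lemma volterra_one (g : ArithmeticFunction ℂ) : volterra g 1 = g - g 1 • 1 := by
  change J (D g * 1) = _
  rw [mul_one]
  ext n
  change (if 2 ≤ n then -(-(g n * (Real.log n : ℂ)) / (Real.log n : ℂ)) else 0) =
    g n - g 1 * (1 : ArithmeticFunction ℂ) n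
  split_ifs with hn
  · have hlog : (Real.log n : ℂ) ≠ 0 := by
      exact_mod_cast (Real.log_pos (by exact_mod_cast hn)).ne'
    rw [ArithmeticFunction.one_apply_ne (by omega), neg_div, neg_neg, mul_div_cancel_right₀ _ hlog,
      mul_zero, sub_zero]
  · interval_cases n <;> simp

lemma mem_HInfPlus_of_volterra_one_mem {g : ArithmeticFunction ℂ}
    (h : volterra g 1 ∈ HInfPlus) : g ∈ HInfPlus := by
  rw [volterra_one] at h
  exact (HInfPlus.sub_mem_iff_left (HInfPlus.smul_mem (g 1) one_mem_HInfPlus)).1 h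

lemma withSeminorms_supSeminorm : WithSeminorms supSeminorm := ⟨rfl⟩

lemma exists_supSeminorm_volterra_le {g : ArithmeticFunction ℂ} (hg : g ∈ HInfPlus)
    (ε : {ε : ℝ // 0 < ε}) : ∃ C : ℝ, ∀ f : HInfPlus,
      supSeminorm ε ⟨volterra g f, volterra_mem_HInfPlus hg f.2⟩ ≤
        C * supSeminorm ⟨ε / 2, half_pos ε.2⟩ f := by
  obtain ⟨L, hL⟩ := exists_norm_partialSum_volterra_le (half_pos ε.2)
  refine ⟨L * supSeminorm ⟨ε / 2, half_pos ε.2⟩ ⟨D g, D_mem_HInfPlus hg⟩, fun f =>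
    supSeminorm_le_of_norm_partialSum_le _ ε fun s hs N => ?_⟩
  rw [mul_assoc]
  exact hL (HInfPlus.isBoundedExtension ⟨D g, D_mem_HInfPlus hg⟩ ⟨ε / 2, half_pos ε.2⟩)
    (HInfPlus.isBoundedExtension f ⟨ε / 2, half_pos ε.2⟩) s (by rwa [add_halves]) N

lemma continuous_volterra_restrict {g : ArithmeticFunction ℂ} (hg : g ∈ HInfPlus)
    (h : ∀ f ∈ HInfPlus, volterra g f ∈ HInfPlus) : Continuous ((volterra g).restrict h) := by
  refine WithSeminorms.continuous_of_isBounded withSeminorms_supSeminorm withSeminorms_supSeminorm _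
    (Seminorm.IsBounded.of_real fun ε => ?_)
  obtain ⟨C, hC⟩ := exists_supSeminorm_volterra_le hg ε
  refine ⟨{⟨ε / 2, half_pos ε.2⟩}, C, fun f => ?_⟩
  rw [Finset.sup_singleton]
  exact hC f

end DirichletSpace

end

theorem corollary1_general (g : ArithmeticFunction ℂ) :
    ((∀ f ∈ DirichletSpace.HInfPlus, DirichletSpace.volterra g f ∈ DirichletSpace.HInfPlus) ↔
      g ∈ DirichletSpace.HInfPlus) ∧
    ∀ h : ∀ f ∈ DirichletSpace.HInfPlus,
        DirichletSpace.volterra g f ∈ DirichletSpace.HInfPlus,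
      Continuous ((DirichletSpace.volterra g).restrict h) := by
  have symbol_mem : (∀ f ∈ DirichletSpace.HInfPlus,
      DirichletSpace.volterra g f ∈ DirichletSpace.HInfPlus) → g ∈ DirichletSpace.HInfPlus :=
    fun h => DirichletSpace.mem_HInfPlus_of_volterra_one_mem
      (h 1 DirichletSpace.one_mem_HInfPlus)
  exact ⟨⟨symbol_mem, fun hg _ => DirichletSpace.volterra_mem_HInfPlus hg⟩,
    fun h => DirichletSpace.continuous_volterra_restrict (symbol_mem h) h⟩

theorem corollary1 (g : ArithmeticFunction ℂ) (hg : DirichletSpace.abscissaOfConv g ≤ 0) :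
    ((∀ f ∈ DirichletSpace.HInfPlus, DirichletSpace.volterra g f ∈ DirichletSpace.HInfPlus) ↔
      g ∈ DirichletSpace.HInfPlus) ∧
    ∀ h : ∀ f ∈ DirichletSpace.HInfPlus,
        DirichletSpace.volterra g f ∈ DirichletSpace.HInfPlus,
      Continuous ((DirichletSpace.volterra g).restrict h) :=
  corollary1_general g
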